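/- Let $k\ge 2$ be an integer and let $q$ be a complex number with $|q|>1$. For $n\ge 0$ write $(1/q)_n=(1-1/q)(1-1/q^2)\cdots(1-1/q^n)$ (so $(1/q)_0=1$), and for non-negative integers $n_1,\dots,n_{k-1}$ put $N_j=n_j+n_{j+1}+\cdots+n_{k-1}$ for $1\le j\le k-1$. Then \[ \sum_{n_1,\dots,n_{k-1}\ge 0}\frac{1}{q^{N_1^2+\cdots+N_{k-1}^2}\,(1/q)_{n_1}\cdots(1/q)_{n_{k-1}}} =\prod_{\substack{r\ge 1\\ r\not\equiv 0,\pm k\ (\mathrm{mod}\ 2k+1)}}\frac{1}{1-(1/q)^r} \] and \[ \sum_{n_1,\dots,n_{k-1}\ge 0}\frac{1}{q^{N_1^2+\cdots+N_{k-1}^2+N_1+\cdots+N_{k-1}}\,(1/q)_{n_1}\cdots(1/q)_{n_{k-1}}} =\prod_{\substack{r\ge 1\\ r\not\equiv 0,\pm 1\ (\mathrm{mod}\ 2k+1)}}\frac{1}{1-(1/q)^r}, \] where both series and both products converge unconditionally. -/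

import Mathlib

open scoped BigOperators

namespace Andrews

/-- `(x)_n = (1 - x)(1 - x/q) ⋯ (1 - x/q^{n-1})`. -/
noncomputable def poch (q x : ℂ) (n : ℕ) : ℂ :=
  ∏ i ∈ Finset.range n, (1 - x / q ^ i)

/-- `N_j = n_j + n_{j+1} + ⋯ + n_m`, where `n = (n_1, …, n_m)`
(the index `j : Fin m` stands for `j + 1`). -/
def tailSum {m : ℕ} (n : Fin m → ℕ) (j : Fin m) : ℕ :=
  ∑ i ∈ Finset.Ici j, n i

/-- The integers `r ≥ 1` with `r ≢ 0, i, -i (mod 2k+1)`. -/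
def allowed (k i : ℕ) : Set ℕ :=
  {r | 1 ≤ r ∧ ¬ (r : ℤ) ≡ 0 [ZMOD (2 * k + 1)] ∧
    ¬ (r : ℤ) ≡ i [ZMOD (2 * k + 1)] ∧ ¬ (r : ℤ) ≡ -i [ZMOD (2 * k + 1)]}

end Andrews

namespace Andrews

open Filter Topology

/-! Put `p = 1/q` and let `e = 0, 1` stand for the first and second identity. The proof is a Bailey
chain in bilateral form. `baileySum` sends a sequence `c` to `∑ c r / ((p)_{N-r} (p)_{N+r+e})`, and
a `q`-Chu–Vandermonde sum shows that summing this against `p^(s^2+es) / (p)_{N-s}` merely multiplies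
`c r` by `p^(r^2+er)` (`baileySum_step`).

The sequence `(-1)^r p^(r(r-1)/2)` has transform `1` at `N = 0` and `0` otherwise
(`baileySum_thetaTerm_one`). Applying `k` steps to it gives a finite form of the multiple series
(`baileySum_chainCoeff`). Letting `N → ∞` turns the series into a theta series over `(p)_∞`
(`tsum_multiTerm`). By the Jacobi triple product this theta series is the product over three residue
classes mod `2k+1`; dividing by `(p)_∞` leaves the reciprocal product over the other classes. -/

/-! ### Gaussian binomials and `q`-Chu–Vandermonde. -/

/-- The `q`-Pochhammer symbol `(p)_n = (1 - p)(1 - p^2) ⋯ (1 - p^n)`. -/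
noncomputable def qp (p : ℂ) (n : ℕ) : ℂ := ∏ i ∈ Finset.range n, (1 - p ^ (i + 1))

/-- The Gaussian binomial coefficient, defined by the `q`-Pascal rule. -/
noncomputable def gaussBinom (p : ℂ) : ℕ → ℕ → ℂ
  | _, 0 => 1
  | 0, _ + 1 => 0
  | n + 1, j + 1 => p ^ (j + 1) * gaussBinom p n (j + 1) + gaussBinom p n j

lemma gaussBinom_zero_right (p : ℂ) (n : ℕ) : gaussBinom p n 0 = 1 := by
  cases n <;> rfl

lemma gaussBinom_succ_succ (p : ℂ) (n j : ℕ) :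
    gaussBinom p (n + 1) (j + 1) = p ^ (j + 1) * gaussBinom p n (j + 1) + gaussBinom p n j := rfl

lemma gaussBinom_eq_zero_of_lt (p : ℂ) {n j : ℕ} (h : n < j) : gaussBinom p n j = 0 := by
  induction n generalizing j with
  | zero => obtain ⟨j, rfl⟩ := Nat.exists_eq_succ_of_ne_zero h.ne'; rfl
  | succ n ih =>
    obtain ⟨j, rfl⟩ := Nat.exists_eq_succ_of_ne_zero (Nat.ne_zero_of_lt h)
    rw [Nat.succ_eq_add_one, gaussBinom_succ_succ, ih (by omega), ih (by omega)]; simp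

lemma qp_succ (p : ℂ) (n : ℕ) : qp p (n + 1) = qp p n * (1 - p ^ (n + 1)) :=
  Finset.prod_range_succ _ _

lemma qp_zero (p : ℂ) : qp p 0 = 1 := by simp [qp]

lemma gaussBinom_self (p : ℂ) (n : ℕ) : gaussBinom p n n = 1 := by
  induction n with
  | zero => rfl
  | succ n ih => rw [gaussBinom_succ_succ, gaussBinom_eq_zero_of_lt p (Nat.lt_succ_self n), ih]; simp

lemma gaussBinom_mul_qp_mul_qp (p : ℂ) (n m : ℕ) :
    gaussBinom p (n + m) m * qp p n * qp p m = qp p (n + m) := by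
  induction m generalizing n with
  | zero => simp [gaussBinom_zero_right, qp_zero]
  | succ m ihm =>
    induction n with
    | zero => simp [gaussBinom_self, qp_zero]
    | succ n ihn =>
      have h1 := ihm (n + 1)
      rw [show n + 1 + (m + 1) = (n + (m + 1)) + 1 by ring, gaussBinom_succ_succ]
      rw [show n + 1 + m = n + (m + 1) by ring] at h1
      rw [qp_succ p (n + (m + 1)), qp_succ p n, qp_succ p m] at *
      linear_combination p ^ (m + 1) * (1 - p ^ (n + 1)) * ihn + (1 - p ^ (m + 1)) * h1

/-- A sum against a row of Gaussian binomials, expanded by the `q`-Pascal rule. -/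
lemma sum_gaussBinom_succ (p : ℂ) (n : ℕ) (f : ℕ → ℂ) :
    ∑ j ∈ Finset.range (n + 2), f j * gaussBinom p (n + 1) j =
      ∑ j ∈ Finset.range (n + 1), (f j * p ^ j + f (j + 1)) * gaussBinom p n j := by
  have h : ∑ j ∈ Finset.range (n + 1), f j * p ^ j * gaussBinom p n j =
      f 0 + ∑ j ∈ Finset.range (n + 1), f (j + 1) * p ^ (j + 1) * gaussBinom p n (j + 1) := by
    rw [Finset.sum_range_succ', Finset.sum_range_succ _ n,
      gaussBinom_eq_zero_of_lt p (Nat.lt_succ_self n), gaussBinom_zero_right]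
    simp [add_comm]
  rw [Finset.sum_range_succ', gaussBinom_zero_right]
  simp only [add_mul, Finset.sum_add_distrib, h, gaussBinom_succ_succ, mul_add]
  simp only [mul_assoc]
  ring

/-- A form of the `q`-Chu–Vandermonde summation. -/
lemma sum_gaussBinom_mul_prod (p x : ℂ) (M : ℕ) :
    ∑ t ∈ Finset.range (M + 1), p ^ (t ^ 2) * x ^ t *
      (∏ i ∈ Finset.range (M - t), (1 - x * p ^ (t + 1 + i))) * gaussBinom p M t = 1 := by
  induction M generalizing x with
  | zero => simp [gaussBinom_zero_right]
  | succ M ih =>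
    rw [sum_gaussBinom_succ p M]
    -- The two Pascal contributions at `t` combine through `(1 - x p^(t+1)) + x p^(t+1) = 1` into
    -- the summand for `x * p`.
    refine Eq.trans ?_ (ih (x * p))
    refine Finset.sum_congr rfl fun t ht => ?_
    have ht : t ≤ M := Nat.lt_succ_iff.mp (Finset.mem_range.mp ht)
    have h1 : ∏ i ∈ Finset.range (M + 1 - t), (1 - x * p ^ (t + 1 + i)) =
        (1 - x * p ^ (t + 1)) * ∏ i ∈ Finset.range (M - t), (1 - x * p * p ^ (t + 1 + i)) := by
      rw [show M + 1 - t = (M - t) + 1 by omega, Finset.prod_range_succ', mul_comm]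
      congr 1
      refine Finset.prod_congr rfl fun i _ => ?_
      ring
    have h2 : ∏ i ∈ Finset.range (M + 1 - (t + 1)), (1 - x * p ^ (t + 1 + 1 + i)) =
        ∏ i ∈ Finset.range (M - t), (1 - x * p * p ^ (t + 1 + i)) := by
      rw [show M + 1 - (t + 1) = M - t by omega]
      refine Finset.prod_congr rfl fun i _ => ?_
      ring
    rw [h1, h2]
    ring

lemma qp_add (p : ℂ) (m n : ℕ) :
    qp p (m + n) = qp p m * ∏ i ∈ Finset.range n, (1 - p ^ (m + i + 1)) :=
  Finset.prod_range_add _ _ _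

lemma one_sub_pow_ne_zero {p : ℂ} (hp : ‖p‖ < 1) {n : ℕ} (hn : n ≠ 0) : 1 - p ^ n ≠ 0 := by
  intro h
  have h1 : ‖p ^ n‖ = 1 := by rw [← sub_eq_zero.mp h, norm_one]
  rw [norm_pow] at h1
  exact (pow_lt_one₀ (norm_nonneg p) hp hn).ne h1

lemma qp_ne_zero {p : ℂ} (hp : ‖p‖ < 1) (n : ℕ) : qp p n ≠ 0 :=
  Finset.prod_ne_zero_iff.mpr fun _ _ => one_sub_pow_ne_zero hp (Nat.succ_ne_zero _)

/-! ### The Bailey step. -/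

/-- `1 / (p)_z` for an integer `z`, with the convention that it vanishes for `z < 0`. -/
noncomputable def invQp (p : ℂ) (z : ℤ) : ℂ := if z < 0 then 0 else (qp p z.toNat)⁻¹

lemma invQp_natCast (p : ℂ) (n : ℕ) : invQp p n = (qp p n)⁻¹ := by simp [invQp]

lemma invQp_of_neg (p : ℂ) {z : ℤ} (h : z < 0) : invQp p z = 0 := by simp [invQp, h]

lemma sum_invQp_nat {p : ℂ} (hp : ‖p‖ < 1) (M b : ℕ) :
    ∑ t ∈ Finset.range (M + 1), p ^ (t ^ 2 + b * t) * (qp p (M - t))⁻¹ * (qp p t)⁻¹ *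
      (qp p (t + b))⁻¹ = (qp p M)⁻¹ * (qp p (M + b))⁻¹ := by
  have hne := qp_ne_zero hp
  have h := sum_gaussBinom_mul_prod p (p ^ b) M
  rw [← mul_one ((qp p M)⁻¹ * (qp p (M + b))⁻¹), ← h, Finset.mul_sum]
  refine Finset.sum_congr rfl fun t ht => ?_
  obtain ⟨s, rfl⟩ := Nat.exists_eq_add_of_le' (Nat.lt_succ_iff.mp (Finset.mem_range.mp ht))
  have h1 := gaussBinom_mul_qp_mul_qp p s t
  have h2 := qp_add p (t + b) s
  have h3 : ∏ i ∈ Finset.range s, (1 - p ^ b * p ^ (t + 1 + i)) =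
      ∏ i ∈ Finset.range s, (1 - p ^ (t + b + i + 1)) :=
    Finset.prod_congr rfl fun i _ => by rw [← pow_add]; congr 2; ring
  have h4 : gaussBinom p (s + t) t = qp p (s + t) * (qp p s)⁻¹ * (qp p t)⁻¹ := by
    rw [← h1]; field_simp [hne]
  have h5 : ∏ i ∈ Finset.range s, (1 - p ^ (t + b + i + 1)) =
      qp p (s + t + b) * (qp p (t + b))⁻¹ := by
    rw [show s + t + b = t + b + s by ring, h2]; field_simp [hne]
  rw [Nat.add_sub_cancel, h3, h4, h5, pow_add, pow_mul]
  have ha := hne (s + t)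
  have hb := hne (s + t + b)
  field_simp

/-- The summation behind the Bailey step, for `0 ≤ r`. -/
lemma sum_invQp_of_nonneg {p : ℂ} (hp : ‖p‖ < 1) (e N r : ℕ) :
    ∑ s ∈ Finset.range (N + 1), p ^ (s ^ 2 + e * s) * invQp p (N - s) * invQp p (s - r) *
      invQp p (s + r + e) = p ^ (r ^ 2 + e * r) * invQp p (N - r) * invQp p (N + r + e) := by
  rcases lt_or_ge N r with hr | hr
  · rw [invQp_of_neg p (show (N : ℤ) - r < 0 by omega)]
    simp only [mul_zero, zero_mul]
    refine Finset.sum_eq_zero fun s hs => ?_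
    have := Finset.mem_range.mp hs
    rw [invQp_of_neg p (show (s : ℤ) - r < 0 by omega)]
    simp
  obtain ⟨M, rfl⟩ := Nat.exists_eq_add_of_le hr
  -- Terms with `s < r` vanish. With `s = r + t` the exponent is `r^2 + er + t^2 + (2r+e)t`, so `b =
  -- 2r + e`.
  rw [show r + M + 1 = r + (M + 1) by ring, Finset.sum_range_add, Finset.sum_eq_zero, zero_add]
  · have h := sum_invQp_nat hp M (2 * r + e)
    rw [show ((r + M : ℕ) : ℤ) - r = (M : ℕ) by push_cast; ring,
      show ((r + M : ℕ) : ℤ) + r + e = (M + (2 * r + e) : ℕ) by push_cast; ring,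
      invQp_natCast, invQp_natCast, mul_assoc, ← h, Finset.mul_sum]
    refine Finset.sum_congr rfl fun t ht => ?_
    have ht := Finset.mem_range.mp ht
    rw [show ((r + M : ℕ) : ℤ) - (r + t : ℕ) = (M - t : ℕ) by omega,
      show ((r + t : ℕ) : ℤ) - r = (t : ℕ) by push_cast; ring,
      show ((r + t : ℕ) : ℤ) + r + e = (t + (2 * r + e) : ℕ) by push_cast; ring,
      invQp_natCast, invQp_natCast, invQp_natCast]
    ring
  · intro s hs
    have := Finset.mem_range.mp hs
    rw [invQp_of_neg p (show (s : ℤ) - r < 0 by omega)]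
    simp

/-- The summation behind the Bailey step. -/
lemma sum_invQp {p : ℂ} (hp : ‖p‖ < 1) {e : ℕ} (he : e ≤ 1) (N : ℕ) (r : ℤ) :
    ∑ s ∈ Finset.range (N + 1), p ^ (s ^ 2 + e * s) * invQp p (N - s) * (invQp p (s - r) *
      invQp p (s + r + e)) = p ^ (r ^ 2 + e * r) * (invQp p (N - r) * invQp p (N + r + e)) := by
  rcases le_or_gt 0 r with hr | hr
  · lift r to ℕ using hr
    have := sum_invQp_of_nonneg hp e N r
    simp only [mul_assoc] at this ⊢
    rw [this]; norm_cast
  -- The reflection `r ↦ -r - e` swaps the two factors and fixes `r^2 + er`; `e ≤ 1` makes it send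
  -- negative `r` to nonnegative ones.
  · obtain ⟨n, hn⟩ := Int.eq_ofNat_of_zero_le (show 0 ≤ -r - e by omega)
    have hr' : r = -n - e := by omega
    subst hr'
    have := sum_invQp_of_nonneg hp e N n
    simp only [mul_assoc] at this ⊢
    rw [show (-(n : ℤ) - e) ^ 2 + e * (-n - e) = (n ^ 2 + e * n : ℕ) by push_cast; ring,
      zpow_natCast, mul_comm (invQp p (N - _)), show (N : ℤ) + (-n - e) + e = N - n by ring,
      show (N : ℤ) - (-n - e) = N + n + e by ring, ← this]
    refine Finset.sum_congr rfl fun s _ => ?_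
    rw [mul_comm (invQp p (s - _)), show (s : ℤ) + (-n - e) + e = s - n by ring,
      show (s : ℤ) - (-n - e) = s + n + e by ring]

/-- The finite bilateral sum transformed by the Bailey step. -/
noncomputable def baileySum (p : ℂ) (e : ℕ) (c : ℤ → ℂ) (N : ℕ) : ℂ :=
  ∑ r ∈ Finset.Icc (-(N + e : ℤ)) N, c r * (invQp p (N - r) * invQp p (N + r + e))

/-- A window independent of `s ≤ N` allows the sums over `s` and `r` to be interchanged in the
Bailey step. -/
lemma baileySum_eq (p : ℂ) (e : ℕ) (c : ℤ → ℂ) {N M : ℕ} (h : N ≤ M) :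
    baileySum p e c N =
      ∑ r ∈ Finset.Icc (-(M + e : ℤ)) M, c r * (invQp p (N - r) * invQp p (N + r + e)) := by
  refine Finset.sum_subset (Finset.Icc_subset_Icc (by omega) (by omega)) fun r _ hr => ?_
  rw [Finset.mem_Icc, not_and_or] at hr
  rcases hr with hr | hr
  · rw [invQp_of_neg p (show (N : ℤ) + r + e < 0 by omega)]; simp
  · rw [invQp_of_neg p (show (N : ℤ) - r < 0 by omega)]; simp

lemma baileySum_step {p : ℂ} (hp : ‖p‖ < 1) {e : ℕ} (he : e ≤ 1) (c : ℤ → ℂ) (N : ℕ) :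
    ∑ s ∈ Finset.range (N + 1), p ^ (s ^ 2 + e * s) * invQp p (N - s) * baileySum p e c s =
      baileySum p e (fun r => p ^ (r ^ 2 + e * r) * c r) N := by
  have h : ∀ s ∈ Finset.range (N + 1),
      p ^ (s ^ 2 + e * s) * invQp p (N - s) * baileySum p e c s =
      ∑ r ∈ Finset.Icc (-(N + e : ℤ)) N, c r * (p ^ (s ^ 2 + e * s) * invQp p (N - s) *
        (invQp p (s - r) * invQp p (s + r + e))) := fun s hs => by
    rw [baileySum_eq p e c (Nat.lt_succ_iff.mp (Finset.mem_range.mp hs)), Finset.mul_sum]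
    exact Finset.sum_congr rfl fun r _ => by ring
  rw [Finset.sum_congr rfl h, Finset.sum_comm, baileySum]
  refine Finset.sum_congr rfl fun r _ => ?_
  rw [← Finset.mul_sum, sum_invQp hp he]
  ring

/-! ### Theta terms and the finite Jacobi triple product. -/

/-- `r(r-1)/2` for an integer `r`. -/
def tri (r : ℤ) : ℤ := r * (r - 1) / 2

lemma two_mul_tri (r : ℤ) : 2 * tri r = r * (r - 1) :=
  Int.mul_ediv_cancel' (Int.even_mul_pred_self r).two_dvd

lemma tri_sub_one (r : ℤ) : tri (r - 1) = tri r - r + 1 := by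
  have h1 := two_mul_tri r
  have h2 := two_mul_tri (r - 1)
  have : 2 * tri (r - 1) = 2 * (tri r - r + 1) := by linear_combination h2 - h1
  omega

lemma tri_natCast_succ (n : ℕ) : tri (n + 1 : ℤ) = tri n + n := by
  have := tri_sub_one (n + 1 : ℤ)
  rw [add_sub_cancel_right] at this
  omega

/-- The general term `(-1)^r x^{r(r-1)/2} z^r` of the theta series. -/
noncomputable def thetaTerm (x z : ℂ) (r : ℤ) : ℂ := (-z) ^ r * x ^ tri r

lemma thetaTerm_natCast_succ {x z : ℂ} (hx : x ≠ 0) (hz : z ≠ 0) (n : ℕ) :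
    thetaTerm x z (n + 1 : ℕ) = -z * thetaTerm x (z * x) n := by
  unfold thetaTerm
  push_cast
  rw [tri_natCast_succ, zpow_add₀ hx, zpow_add_one₀ (neg_ne_zero.mpr hz), ← neg_mul, mul_zpow]
  ring

lemma thetaTerm_sub_one {x z : ℂ} (hx : x ≠ 0) (hz : z ≠ 0) (r : ℤ) :
    thetaTerm x z (r - 1) = -(x / z) * thetaTerm x (z / x) r := by
  unfold thetaTerm
  rw [tri_sub_one, zpow_add_one₀ hx, zpow_sub₀ hx, zpow_sub_one₀ (neg_ne_zero.mpr hz),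
    ← neg_div x z, div_zpow]
  have := zpow_ne_zero r hx
  field_simp

/-- The `q`-binomial theorem. -/
lemma sum_thetaTerm_gaussBinom {x z : ℂ} (hx : x ≠ 0) (hz : z ≠ 0) (n : ℕ) :
    ∑ j ∈ Finset.range (n + 1), thetaTerm x z j * gaussBinom x n j =
      ∏ i ∈ Finset.range n, (1 - z * x ^ i) := by
  induction n generalizing z with
  | zero => simp [thetaTerm, tri, gaussBinom_zero_right]
  | succ n ih =>
    rw [sum_gaussBinom_succ x n (fun j => thetaTerm x z j), Finset.prod_range_succ']
    have h : ∀ j ∈ Finset.range (n + 1),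
        (thetaTerm x z j * x ^ j + thetaTerm x z (j + 1 : ℕ)) * gaussBinom x n j =
          (1 - z) * (thetaTerm x (z * x) j * gaussBinom x n j) := fun j _ => by
      rw [thetaTerm_natCast_succ hx hz]
      have : thetaTerm x z j * x ^ j = thetaTerm x (z * x) j := by
        simp only [thetaTerm, ← neg_mul, zpow_natCast]; ring
      rw [this]; ring
    rw [Finset.sum_congr rfl h, ← Finset.mul_sum, ih (mul_ne_zero hz hx), pow_zero, mul_one,
      mul_comm]
    congr 1
    exact Finset.prod_congr rfl fun i _ => by ring

/-- The finite Jacobi triple product, summed over a row of Gaussian binomials. -/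
lemma finite_jacobi_gaussBinom {x z : ℂ} (hx : x ≠ 0) (hz : z ≠ 0) (a b : ℕ) :
    ∑ j ∈ Finset.range (a + b + 1), thetaTerm x z (j - a) * gaussBinom x (a + b) j =
      (∏ i ∈ Finset.range b, (1 - z * x ^ i)) * ∏ i ∈ Finset.range a, (1 - x ^ (i + 1) / z) := by
  induction a generalizing b z with
  | zero => simpa using sum_thetaTerm_gaussBinom hx hz b
  | succ a ih =>
    -- Replacing `z` by `z/x` shifts the theta index by one; the extra factor `1 - z/x` becomes `1 -
    -- x/z` after multiplication by `-(x/z)`.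
    have h := ih (div_ne_zero hz hx) (b + 1)
    have h1 : ∏ i ∈ Finset.range (b + 1), (1 - z / x * x ^ i) =
        (∏ i ∈ Finset.range b, (1 - z * x ^ i)) * (1 - z / x) := by
      rw [Finset.prod_range_succ']
      congr 1
      · exact Finset.prod_congr rfl fun i _ => by rw [pow_succ]; field_simp
      · simp
    have h2 : ∏ i ∈ Finset.range a, (1 - x ^ (i + 1) / (z / x)) =
        ∏ i ∈ Finset.range a, (1 - x ^ (i + 1 + 1) / z) :=
      Finset.prod_congr rfl fun i _ => by rw [pow_succ x (i + 1)]; field_simp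
    rw [h1, h2] at h
    rw [Finset.prod_range_succ' _ a, show a + 1 + b = a + (b + 1) by ring]
    have h3 : ∀ j ∈ Finset.range (a + (b + 1) + 1),
        thetaTerm x z (j - (a + 1 : ℕ)) * gaussBinom x (a + (b + 1)) j =
        -(x / z) * (thetaTerm x (z / x) (j - a) * gaussBinom x (a + (b + 1)) j) := fun j _ => by
      rw [show (j : ℤ) - (a + 1 : ℕ) = (j - a : ℤ) - 1 by push_cast; ring,
        thetaTerm_sub_one hx hz, mul_assoc]
    rw [Finset.sum_congr rfl h3, ← Finset.mul_sum, h]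
    have h4 : 1 - x ^ (0 + 1) / z = -(x / z) * (1 - z / x) := by field_simp; ring
    rw [h4]
    ring

/-- The finite Jacobi triple product. -/
lemma finite_jacobi {x z : ℂ} (hx1 : ‖x‖ < 1) (hx : x ≠ 0) (hz : z ≠ 0) (e N : ℕ) :
    qp x (N + e + N) * baileySum x e (thetaTerm x z) N =
      (∏ i ∈ Finset.range N, (1 - z * x ^ i)) *
        ∏ i ∈ Finset.range (N + e), (1 - x ^ (i + 1) / z) := by
  rw [← finite_jacobi_gaussBinom hx hz, baileySum, Finset.mul_sum]
  symm
  refine Finset.sum_bij (fun j _ => (j : ℤ) - (N + e : ℕ)) ?_ ?_ ?_ ?_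
  · intro j hj
    have := Finset.mem_range.mp hj
    rw [Finset.mem_Icc]; push_cast; omega
  · intro i _ j _ h
    simpa using h
  · intro r hr
    rw [Finset.mem_Icc] at hr
    refine ⟨(r + (N + e : ℕ)).toNat, ?_, ?_⟩
    · rw [Finset.mem_range]; omega
    · rw [Int.toNat_of_nonneg (by push_cast; omega)]; ring
  · intro j hj
    have hj := Finset.mem_range.mp hj
    obtain ⟨s, hs⟩ := Nat.exists_eq_add_of_le' (show j ≤ N + e + N by omega)
    rw [show (N : ℤ) - (j - (N + e : ℕ)) = (s : ℕ) by omega,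
      show (N : ℤ) + (j - (N + e : ℕ)) + e = (j : ℕ) by push_cast; ring, invQp_natCast,
      invQp_natCast, hs, ← gaussBinom_mul_qp_mul_qp]
    have h1 := qp_ne_zero hx1 s
    have h2 := qp_ne_zero hx1 j
    field_simp

/-- At `z = 1` the factor `1 - z x^0` kills the finite triple product as soon as `N ≥ 1`. This is
the unit Bailey pair that starts the chain. -/
lemma baileySum_thetaTerm_one {p : ℂ} (hp : ‖p‖ < 1) (hp0 : p ≠ 0) (e N : ℕ) :
    baileySum p e (thetaTerm p 1) N = if N = 0 then 1 else 0 := by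
  have h := finite_jacobi hp hp0 one_ne_zero e N
  have hne := qp_ne_zero hp (N + e + N)
  rw [← mul_right_inj' hne, h]
  rcases N with _ | N
  · simp [qp]
  · rw [Finset.prod_range_succ' _ N]; simp

/-! ### Infinite products and the limit `N → ∞`. -/

/-- The infinite product `(p)_∞ = ∏ (1 - p^n)`. -/
noncomputable def qpInf (p : ℂ) : ℂ := ∏' n : ℕ, (1 - p ^ (n + 1))

lemma summable_norm_pow_of_injective {p : ℂ} (hp : ‖p‖ < 1) {ι : Type*} {g : ι → ℕ}
    (hg : Function.Injective g) : Summable fun i => ‖-p ^ g i‖ := by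
  simpa [Function.comp_def] using
    (summable_geometric_of_lt_one (norm_nonneg p) hp).comp_injective hg

lemma multipliable_one_sub_pow_of_injective {p : ℂ} (hp : ‖p‖ < 1) {ι : Type*} {g : ι → ℕ}
    (hg : Function.Injective g) : Multipliable fun i => 1 - p ^ g i := by
  simpa [sub_eq_add_neg] using
    multipliable_one_add_of_summable (summable_norm_pow_of_injective hp hg)

lemma tprod_one_sub_pow_ne_zero {p : ℂ} (hp : ‖p‖ < 1) {ι : Type*} {g : ι → ℕ}
    (hg : Function.Injective g) (hg0 : ∀ i, g i ≠ 0) : ∏' i, (1 - p ^ g i) ≠ 0 := by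
  simpa [sub_eq_add_neg] using tprod_one_add_ne_zero_of_summable (f := fun i => -p ^ g i)
    (fun i => by simpa [sub_eq_add_neg] using one_sub_pow_ne_zero hp (hg0 i))
    (summable_norm_pow_of_injective hp hg)

lemma qpInf_ne_zero {p : ℂ} (hp : ‖p‖ < 1) : qpInf p ≠ 0 :=
  tprod_one_sub_pow_ne_zero hp (add_left_injective 1) fun _ => Nat.succ_ne_zero _

lemma tendsto_qp {p : ℂ} (hp : ‖p‖ < 1) : Tendsto (qp p) atTop (𝓝 (qpInf p)) :=
  (multipliable_one_sub_pow_of_injective hp (add_left_injective 1)).hasProd.tendsto_prod_nat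

lemma tendsto_inv_qp {p : ℂ} (hp : ‖p‖ < 1) :
    Tendsto (fun n => (qp p n)⁻¹) atTop (𝓝 (qpInf p)⁻¹) :=
  (tendsto_qp hp).inv₀ (qpInf_ne_zero hp)

lemma tendsto_invQp {p : ℂ} (hp : ‖p‖ < 1) (z : ℤ) :
    Tendsto (fun N : ℕ => invQp p (N + z)) atTop (𝓝 (qpInf p)⁻¹) := by
  have h : Tendsto (fun N : ℕ => ((N : ℤ) + z).toNat) atTop atTop := by
    refine tendsto_atTop.mpr fun b => ?_
    filter_upwards [eventually_ge_atTop (b + z.natAbs)] with N hN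
    omega
  refine ((tendsto_inv_qp hp).comp h).congr' ?_
  filter_upwards [eventually_ge_atTop z.natAbs] with N hN
  rw [Function.comp_apply, ← invQp_natCast, Int.toNat_of_nonneg (by omega)]

lemma exists_norm_invQp_le {p : ℂ} (hp : ‖p‖ < 1) : ∃ C : ℝ, 0 ≤ C ∧ ∀ z, ‖invQp p z‖ ≤ C := by
  obtain ⟨C, hC⟩ := (Metric.isBounded_range_of_tendsto _ (tendsto_inv_qp hp)).exists_norm_le
  have hC0 : 0 ≤ C := (norm_nonneg _).trans (hC _ ⟨0, rfl⟩)
  refine ⟨C, hC0, fun z => ?_⟩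
  rcases lt_or_ge z 0 with h | h
  · simpa [invQp_of_neg p h] using hC0
  · lift z to ℕ using h
    rw [invQp_natCast]
    exact hC _ ⟨z, rfl⟩

lemma baileySum_eq_tsum (p : ℂ) (e : ℕ) (c : ℤ → ℂ) (N : ℕ) :
    baileySum p e c N = ∑' r, c r * (invQp p (N - r) * invQp p (N + r + e)) := by
  refine (tsum_eq_sum fun r hr => ?_).symm
  rw [Finset.mem_Icc, not_and_or] at hr
  rcases hr with hr | hr
  · rw [invQp_of_neg p (show (N : ℤ) + r + e < 0 by omega)]; simp
  · rw [invQp_of_neg p (show (N : ℤ) - r < 0 by omega)]; simp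

/-- Dominated convergence: the `invQp` factors are uniformly bounded and each tends to `1/(p)_∞`. -/
lemma tendsto_baileySum {p : ℂ} (hp : ‖p‖ < 1) (e : ℕ) {c : ℤ → ℂ} (hc : Summable fun r => ‖c r‖) :
    Tendsto (baileySum p e c) atTop (𝓝 ((∑' r, c r) * ((qpInf p)⁻¹ * (qpInf p)⁻¹))) := by
  obtain ⟨C, hC0, hC⟩ := exists_norm_invQp_le hp
  rw [funext (baileySum_eq_tsum p e c), ← tsum_mul_right]
  refine tendsto_tsum_of_dominated_convergence (hc.mul_right (C * C)) (fun r => ?_) ?_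
  · refine (Tendsto.mul ?_ ?_).const_mul _
    · simpa [sub_eq_add_neg] using tendsto_invQp hp (-r)
    · simpa [add_assoc] using tendsto_invQp hp (r + e)
  · refine Eventually.of_forall fun N r => ?_
    rw [norm_mul, norm_mul]
    gcongr <;> apply hC

/-- The Jacobi triple product identity. -/
lemma jacobi_triple_product {x z : ℂ} (hx1 : ‖x‖ < 1) (hx : x ≠ 0) (hz : z ≠ 0)
    (hs : Summable fun r => ‖thetaTerm x z r‖)
    (h1 : Multipliable fun n : ℕ => 1 - z * x ^ n)
    (h2 : Multipliable fun n : ℕ => 1 - x ^ (n + 1) / z) :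
    ∑' r, thetaTerm x z r =
      qpInf x * ((∏' n : ℕ, (1 - z * x ^ n)) * ∏' n : ℕ, (1 - x ^ (n + 1) / z)) := by
  have hL : Tendsto (fun N => qp x (N + 0 + N) * baileySum x 0 (thetaTerm x z) N) atTop
      (𝓝 (qpInf x * ((∑' r, thetaTerm x z r) * ((qpInf x)⁻¹ * (qpInf x)⁻¹)))) :=
    Tendsto.mul ((tendsto_qp hx1).comp
      (tendsto_atTop_mono (fun n => Nat.le_add_left n (n + 0)) tendsto_id))
      (tendsto_baileySum hx1 0 hs)
  have hR := h1.hasProd.tendsto_prod_nat.mul h2.hasProd.tendsto_prod_nat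
  rw [← tendsto_nhds_unique (hL.congr fun N => finite_jacobi hx1 hx hz 0 N) hR]
  have := qpInf_ne_zero hx1
  field_simp

/-! ### The multiple series. -/

/-- The general term of the multiple series. -/
noncomputable def multiTerm (p : ℂ) (e : ℕ) {m : ℕ} (n : Fin m → ℕ) : ℂ :=
  p ^ (∑ j, tailSum n j ^ 2 + e * ∑ j, tailSum n j) * ∏ j, (qp p (n j))⁻¹

lemma tailSum_cons_succ {m : ℕ} (a : ℕ) (n : Fin m → ℕ) (j : Fin m) :
    tailSum (Fin.cons a n : Fin (m + 1) → ℕ) j.succ = tailSum n j := by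
  unfold tailSum
  rw [← Fin.map_succEmb_Ici, Finset.sum_map]
  simp

lemma tailSum_zero {m : ℕ} (n : Fin (m + 1) → ℕ) : tailSum n 0 = ∑ i, n i := by
  unfold tailSum
  congr 1
  ext i
  simp

lemma le_tailSum {m : ℕ} (n : Fin m → ℕ) (j : Fin m) : n j ≤ tailSum n j :=
  Finset.single_le_sum (f := n) (fun _ _ => Nat.zero_le _) (by simp)

lemma multiTerm_cons (p : ℂ) (e : ℕ) {m : ℕ} (a : ℕ) (n : Fin m → ℕ) :
    multiTerm p e (Fin.cons a n : Fin (m + 1) → ℕ) =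
      p ^ ((a + ∑ i, n i) ^ 2 + e * (a + ∑ i, n i)) * (qp p a)⁻¹ * multiTerm p e n := by
  unfold multiTerm
  simp only [Fin.sum_univ_succ, Fin.prod_univ_succ, tailSum_cons_succ, tailSum_zero, Fin.cons_zero,
    Fin.cons_succ]
  ring

lemma summable_prod_pow {x : ℝ} (h0 : 0 ≤ x) (h1 : x < 1) (m : ℕ) :
    Summable fun n : Fin m → ℕ => ∏ j, x ^ n j := by
  induction m with
  | zero => exact (hasSum_fintype _).summable
  | succ m ih =>
    rw [← (Fin.consEquiv fun _ : Fin (m + 1) => ℕ).summable_iff]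
    have := (summable_geometric_of_lt_one h0 h1).mul_of_nonneg ih (fun _ => by positivity)
      (fun _ => Finset.prod_nonneg fun _ _ => by positivity)
    refine this.congr fun y => ?_
    simp [Fin.prod_univ_succ, Fin.consEquiv]

/-- Since `n_j ≤ N_j ≤ N_j^2` and the `1/(p)_n` are bounded, a product of geometric series
dominates. -/
lemma summable_norm_multiTerm {p : ℂ} (hp : ‖p‖ < 1) (e m : ℕ) :
    Summable fun n : Fin m → ℕ => ‖multiTerm p e n‖ := by
  obtain ⟨C, hC0, hC⟩ := exists_norm_invQp_le hp
  refine Summable.of_nonneg_of_le (fun _ => norm_nonneg _) (fun n => ?_)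
    ((summable_prod_pow (norm_nonneg p) hp m).mul_right (C ^ m))
  rw [multiTerm, norm_mul, norm_pow, norm_prod, Finset.prod_pow_eq_pow_sum]
  gcongr ?_ * ?_
  · refine pow_le_pow_of_le_one (norm_nonneg _) hp.le
      ((Finset.sum_le_sum fun j _ => ?_).trans (Nat.le_add_right _ _))
    exact (le_tailSum n j).trans (Nat.le_self_pow two_ne_zero _)
  · refine (Finset.prod_le_prod (g := fun _ => C) (fun _ _ => norm_nonneg _)
      fun j _ => ?_).trans (le_of_eq (by simp))
    rw [← invQp_natCast]
    exact hC _

lemma summable_multiTerm_mul_invQp {p : ℂ} (hp : ‖p‖ < 1) (e m : ℕ) (z : (Fin m → ℕ) → ℤ) :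
    Summable fun n : Fin m → ℕ => multiTerm p e n * invQp p (z n) := by
  obtain ⟨C, hC0, hC⟩ := exists_norm_invQp_le hp
  refine Summable.of_norm_bounded ((summable_norm_multiTerm hp e m).mul_right C) fun n => ?_
  rw [norm_mul]
  gcongr
  exact hC _

lemma tsum_shift_invQp (p : ℂ) (u : ℕ → ℂ) (d N : ℕ) :
    ∑' a : ℕ, u (a + d) * (qp p a)⁻¹ * invQp p (N - (a + d : ℕ)) =
      ∑ s ∈ Finset.range (N + 1), u s * invQp p (N - s) * invQp p (s - d) := by
  rw [← tsum_eq_sum (L := SummationFilter.unconditional ℕ)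
    (f := fun s : ℕ => u s * invQp p (N - s) * invQp p (s - d)), ← (add_left_injective d).tsum_eq
      (f := fun s : ℕ => u s * invQp p (N - s) * invQp p (s - d))]
  · refine tsum_congr fun a => ?_
    rw [show ((a + d : ℕ) : ℤ) - d = (a : ℕ) by push_cast; ring, invQp_natCast]
    ring
  · intro s hs
    refine ⟨s - d, Nat.sub_add_cancel ?_⟩
    by_contra h
    exact hs (by simp only [invQp_of_neg p (show (s : ℤ) - d < 0 by omega), mul_zero])
  · intro s hs
    rw [Finset.mem_range] at hs
    rw [invQp_of_neg p (show (N : ℤ) - s < 0 by omega)]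
    simp

lemma tsum_fin_succ {m : ℕ} {f : (Fin (m + 1) → ℕ) → ℂ} (hf : Summable f) :
    ∑' n, f n = ∑' n : Fin m → ℕ, ∑' a : ℕ, f (Fin.cons a n) := by
  let E : (Fin m → ℕ) × ℕ ≃ (Fin (m + 1) → ℕ) :=
    (Equiv.prodComm _ _).trans (Fin.consEquiv fun _ : Fin (m + 1) => ℕ)
  rw [← E.tsum_eq f]
  exact Summable.tsum_prod (E.summable_iff.mpr hf)

/-- Summing over `n_1` with `s = N_1` gives the recursion that `baileySum_chainCoeff_succ` gives on
the other side; `1/(p)_{n_1}` becomes the inner factor `invQp p (s - ∑ n_i)`. -/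
lemma tsum_multiTerm_succ {p : ℂ} (hp : ‖p‖ < 1) (e m N : ℕ) :
    ∑' n : Fin (m + 1) → ℕ, multiTerm p e n * invQp p (N - (∑ i, n i : ℕ)) =
      ∑ s ∈ Finset.range (N + 1), p ^ (s ^ 2 + e * s) * invQp p (N - s) *
        ∑' n : Fin m → ℕ, multiTerm p e n * invQp p (s - (∑ i, n i : ℕ)) := by
  rw [tsum_fin_succ (summable_multiTerm_mul_invQp hp e (m + 1) fun n => N - (∑ i, n i : ℕ))]
  simp only [← tsum_mul_left]
  rw [← Summable.tsum_finsetSum fun (s : ℕ) _ =>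
    (summable_multiTerm_mul_invQp hp e m (fun n => (s : ℤ) - (∑ i, n i : ℕ))).mul_left _]
  refine tsum_congr fun n => ?_
  have h := tsum_shift_invQp p (fun s => p ^ (s ^ 2 + e * s)) (∑ i, n i) N
  have h' : ∀ a : ℕ, multiTerm p e (Fin.cons a n : Fin (m + 1) → ℕ) *
        invQp p (N - (∑ i, (Fin.cons a n : Fin (m + 1) → ℕ) i : ℕ)) =
      multiTerm p e n * (p ^ ((a + ∑ i, n i) ^ 2 + e * (a + ∑ i, n i)) * (qp p a)⁻¹ *
        invQp p (N - (a + ∑ i, n i : ℕ))) := fun a => by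
    rw [multiTerm_cons, Fin.sum_univ_succ]
    simp only [Fin.cons_zero, Fin.cons_succ]
    ring
  simp only [h', tsum_mul_left, h, Finset.mul_sum]
  exact Finset.sum_congr rfl fun s _ => by ring

/-! ### The Bailey chain and its limit. -/

/-- The sequence obtained from the unit sequence by `m` Bailey steps. -/
noncomputable def chainCoeff (p : ℂ) (e m : ℕ) (r : ℤ) : ℂ :=
  (p ^ (r ^ 2 + e * r)) ^ m * thetaTerm p 1 r

lemma baileySum_chainCoeff_succ {p : ℂ} (hp : ‖p‖ < 1) {e : ℕ} (he : e ≤ 1) (m N : ℕ) :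
    baileySum p e (chainCoeff p e (m + 1)) N = ∑ s ∈ Finset.range (N + 1),
      p ^ (s ^ 2 + e * s) * invQp p (N - s) * baileySum p e (chainCoeff p e m) s := by
  rw [baileySum_step hp he]
  congr 1
  ext r
  simp only [chainCoeff, pow_succ]
  ring

lemma baileySum_chainCoeff {p : ℂ} (hp : ‖p‖ < 1) (hp0 : p ≠ 0) {e : ℕ} (he : e ≤ 1) (m N : ℕ) :
    baileySum p e (chainCoeff p e (m + 1)) N =
      ∑' n : Fin m → ℕ, multiTerm p e n * invQp p (N - (∑ i, n i : ℕ)) := by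
  induction m generalizing N with
  | zero =>
    have h0 : chainCoeff p e 0 = thetaTerm p 1 := by ext r; simp [chainCoeff]
    rw [baileySum_chainCoeff_succ hp he, h0, Finset.sum_eq_single 0]
    · simp [baileySum_thetaTerm_one hp hp0, multiTerm]
    · intro s _ hs
      simp [baileySum_thetaTerm_one hp hp0, hs]
    · simp
  | succ m ih => rw [baileySum_chainCoeff_succ hp he, tsum_multiTerm_succ hp]; simp only [ih]

lemma summable_pow_natAbs {x : ℝ} (h0 : 0 ≤ x) (h1 : x < 1) :
    Summable fun r : ℤ => x ^ (r.natAbs - 1) := by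
  have h : Summable fun n : ℕ => x ^ (n - 1) :=
    (summable_nat_add_iff 1).mp (by simpa using summable_geometric_of_lt_one h0 h1)
  exact Summable.of_nat_of_neg (by simpa using h) (by simpa using h)

lemma natAbs_sub_one_le_tri (r : ℤ) : ((r.natAbs - 1 : ℕ) : ℤ) ≤ tri r := by
  have h := two_mul_tri r
  rcases le_or_gt 1 r with hr | hr
  · rw [show ((r.natAbs - 1 : ℕ) : ℤ) = r - 1 by omega]
    rcases eq_or_lt_of_le hr with rfl | hr'
    · simp [tri]
    · nlinarith
  · rcases eq_or_lt_of_le (show r ≤ 0 by omega) with rfl | hr'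
    · simp [tri]
    · rw [show ((r.natAbs - 1 : ℕ) : ℤ) = -r - 1 by omega]; nlinarith

lemma summable_norm_chainCoeff {p : ℂ} (hp : ‖p‖ < 1) (hp0 : p ≠ 0) {e : ℕ} (he : e ≤ 1) (m : ℕ) :
    Summable fun r => ‖chainCoeff p e m r‖ := by
  refine Summable.of_nonneg_of_le (fun _ => norm_nonneg _) (fun r => ?_)
    (summable_pow_natAbs (norm_nonneg p) hp)
  have hr : 0 ≤ r ^ 2 + e * r := by
    rcases le_or_gt 0 r with hr | hr
    · positivity
    · have : (e : ℤ) ≤ 1 := by exact_mod_cast he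
      nlinarith
  have hpos := norm_pos_iff.mpr hp0
  -- The chain weights only help, so the theta factor alone gives summability.
  have h1 : ‖p‖ ^ (r ^ 2 + e * r) ≤ 1 := by
    simpa using zpow_le_zpow_right_of_le_one₀ hpos hp.le hr
  have h2 : ‖p‖ ^ tri r ≤ ‖p‖ ^ ((r.natAbs - 1 : ℕ) : ℤ) :=
    zpow_le_zpow_right_of_le_one₀ hpos hp.le (natAbs_sub_one_le_tri r)
  rw [zpow_natCast] at h2
  rw [chainCoeff, thetaTerm, norm_mul, norm_pow, norm_zpow, norm_mul, norm_zpow, norm_zpow,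
    norm_neg, norm_one, one_zpow, one_mul]
  calc _ ≤ 1 * ‖p‖ ^ tri r := by
        gcongr
        exact pow_le_one₀ (by positivity) h1
    _ ≤ _ := by rw [one_mul]; exact h2

/-- The multiple series as a theta series divided by `(p)_∞`. -/
lemma tsum_multiTerm {p : ℂ} (hp : ‖p‖ < 1) (hp0 : p ≠ 0) {e : ℕ} (he : e ≤ 1) (m : ℕ) :
    ∑' n : Fin m → ℕ, multiTerm p e n = (∑' r, chainCoeff p e (m + 1) r) * (qpInf p)⁻¹ := by
  obtain ⟨C, hC0, hC⟩ := exists_norm_invQp_le hp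
  have hL := tendsto_baileySum hp e (summable_norm_chainCoeff hp hp0 he (m + 1))
  have hR : Tendsto (fun N : ℕ => ∑' n : Fin m → ℕ, multiTerm p e n * invQp p (N - (∑ i, n i : ℕ)))
      atTop (𝓝 (∑' n : Fin m → ℕ, multiTerm p e n * (qpInf p)⁻¹)) := by
    refine tendsto_tsum_of_dominated_convergence ((summable_norm_multiTerm hp e m).mul_right C)
      (fun n => ?_) (Eventually.of_forall fun N n => ?_)
    · refine Tendsto.const_mul _ ?_
      simpa [sub_eq_add_neg] using tendsto_invQp hp (-(∑ i, n i : ℕ))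
    · rw [norm_mul]
      gcongr
      exact hC _
  have h := tendsto_nhds_unique hL (hR.congr fun N => (baileySum_chainCoeff hp hp0 he m N).symm)
  rw [tsum_mul_right, ← mul_assoc] at h
  exact (mul_right_cancel₀ (inv_ne_zero (qpInf_ne_zero hp)) h).symm

/-- Exponents agree: `k(r^2 + er) + r(r-1)/2 = (2k+1) r(r-1)/2 + k(e+1) r`. -/
lemma chainCoeff_eq_thetaTerm {p : ℂ} (hp0 : p ≠ 0) (e k : ℕ) (r : ℤ) :
    chainCoeff p e k r = thetaTerm (p ^ (2 * k + 1)) (p ^ (k * (e + 1))) r := by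
  have h := two_mul_tri r
  have h1 : (-(p ^ (k * (e + 1)))) ^ r = (-1) ^ r * p ^ ((k * (e + 1) : ℕ) * r) := by
    rw [neg_eq_neg_one_mul, mul_zpow, ← zpow_natCast, ← zpow_mul]
  rw [chainCoeff, thetaTerm, thetaTerm, h1, ← zpow_natCast, ← zpow_natCast, ← zpow_mul, ← zpow_mul,
    mul_left_comm, mul_assoc, ← zpow_add₀ hp0, ← zpow_add₀ hp0]
  congr 2
  push_cast
  linear_combination (-(k : ℤ)) * h

/-! ### Splitting `(p)_∞` by residue classes. -/

/-- The arithmetic progression `c, c + d, c + 2d, …`. -/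
def progression (c d : ℕ) : Set ℕ := Set.range fun n : ℕ => c + d * n

lemma injective_add_mul (c : ℕ) {d : ℕ} (hd : 0 < d) :
    Function.Injective fun n : ℕ => c + d * n := fun m n h => by
  simpa [hd.ne'] using h

lemma mod_of_mem_progression {c d r : ℕ} (hr : r ∈ progression c d) : r % d = c % d := by
  obtain ⟨n, rfl⟩ := hr
  exact Nat.add_mul_mod_self_left _ _ _

lemma le_of_mem_progression {c d r : ℕ} (hr : r ∈ progression c d) : c ≤ r := by
  obtain ⟨n, rfl⟩ := hr
  exact Nat.le_add_right _ _

lemma mem_progression_of_mod {c d r : ℕ} (h : r % d = c) : r ∈ progression c d :=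
  ⟨r / d, by have := Nat.mod_add_div r d; rw [h] at this; exact this⟩

lemma mem_progression_self {d r : ℕ} (hr : 1 ≤ r) (h : r % d = 0) : r ∈ progression d d := by
  have hdiv := Nat.mod_add_div r d
  obtain ⟨t, ht⟩ : ∃ t, r / d = t + 1 :=
    Nat.exists_eq_succ_of_ne_zero fun h' => by rw [h', h] at hdiv; omega
  refine ⟨t, ?_⟩
  rw [h, ht] at hdiv
  show d + d * t = r
  linarith

lemma hasProd_progression {p : ℂ} (hp : ‖p‖ < 1) (c : ℕ) {d : ℕ} (hd : 0 < d) :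
    HasProd ((fun r : ℕ => 1 - p ^ r) ∘ ((↑) : progression c d → ℕ))
      (∏' n : ℕ, (1 - p ^ (c + d * n))) := by
  have h := (multipliable_one_sub_pow_of_injective hp (injective_add_mul c hd)).hasProd
  exact ((injective_add_mul c hd).hasProd_range_iff (f := fun r : ℕ => 1 - p ^ r)).mpr h

/-- Removing from the positive integers the multiples of `d` and the residue classes of `a`
and `b` splits three products off `(p)_∞`. -/
lemma qpInf_eq_tprod_mul {p : ℂ} (hp : ‖p‖ < 1) {a b d : ℕ} (ha : 0 < a) (hb : 0 < b)
    (hab : a ≠ b) (had : a < d) (hbd : b < d) {A : Set ℕ}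
    (hA : ∀ r, r ∈ A ↔ 1 ≤ r ∧ r % d ≠ 0 ∧ r % d ≠ a ∧ r % d ≠ b) :
    qpInf p = (∏' r : A, (1 - p ^ (r : ℕ))) * (qpInf (p ^ d) *
      ((∏' n : ℕ, (1 - p ^ (a + d * n))) * ∏' n : ℕ, (1 - p ^ (b + d * n)))) := by
  have hma : ∀ {r}, r ∈ progression a d → r % d = a := fun h =>
    (mod_of_mem_progression h).trans (Nat.mod_eq_of_lt had)
  have hmb : ∀ {r}, r ∈ progression b d → r % d = b := fun h =>
    (mod_of_mem_progression h).trans (Nat.mod_eq_of_lt hbd)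
  have hmd : ∀ {r}, r ∈ progression d d → r % d = 0 := fun h =>
    (mod_of_mem_progression h).trans (Nat.mod_self d)
  have d1 : Disjoint (progression a d) (progression b d) := by
    rw [Set.disjoint_left]
    intro r h h'
    exact hab ((hma h).symm.trans (hmb h'))
  have d2 : Disjoint (progression d d) (progression a d ∪ progression b d) := by
    rw [Set.disjoint_left]
    rintro r h (h' | h')
    · exact ha.ne ((hmd h).symm.trans (hma h'))
    · exact hb.ne ((hmd h).symm.trans (hmb h'))
  have d3 : Disjoint A (progression d d ∪ (progression a d ∪ progression b d)) := by
    rw [Set.disjoint_left]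
    intro r h h'
    obtain ⟨-, h0, h1, h2⟩ := (hA r).mp h
    rcases h' with h' | h' | h'
    · exact h0 (hmd h')
    · exact h1 (hma h')
    · exact h2 (hmb h')
  have hU : A ∪ (progression d d ∪ (progression a d ∪ progression b d)) = progression 1 1 := by
    ext r
    constructor
    · intro h
      have hr : 1 ≤ r := by
        rcases h with h | h | h | h
        · exact ((hA r).mp h).1
        · have := le_of_mem_progression h; omega
        · have := le_of_mem_progression h; omega
        · have := le_of_mem_progression h; omega
      exact mem_progression_self hr (Nat.mod_one r)
    · intro h
      have hr := le_of_mem_progression h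
      by_cases h0 : r % d = 0
      · exact Or.inr (Or.inl (mem_progression_self hr h0))
      by_cases h1 : r % d = a
      · exact Or.inr (Or.inr (Or.inl (mem_progression_of_mod h1)))
      by_cases h2 : r % d = b
      · exact Or.inr (Or.inr (Or.inr (mem_progression_of_mod h2)))
      exact Or.inl ((hA r).mpr ⟨hr, h0, h1, h2⟩)
  have hd : 0 < d := by omega
  have hAp : HasProd ((fun r : ℕ => 1 - p ^ r) ∘ ((↑) : A → ℕ)) (∏' r : A, (1 - p ^ (r : ℕ))) :=
    (multipliable_one_sub_pow_of_injective hp Subtype.val_injective).hasProd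
  have hP := hAp.mul_disjoint d3 ((hasProd_progression hp d hd).mul_disjoint d2
    ((hasProd_progression hp a hd).mul_disjoint d1 (hasProd_progression hp b hd)))
  rw [hU] at hP
  have hx : qpInf (p ^ d) = ∏' n : ℕ, (1 - p ^ (d + d * n)) :=
    tprod_congr fun n => by rw [← pow_mul]; ring
  have h1 : qpInf p = ∏' n : ℕ, (1 - p ^ (1 + 1 * n)) :=
    tprod_congr fun n => by ring
  rw [hx, h1]
  exact (hasProd_progression hp 1 one_pos).unique hP

/-- With `k = m + 1`, `e = 0` gives `(a, b) = (k, k+1)` and `e = 1` gives `(2k, 1)`: the classes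
`±k` and `±1` mod `2k+1`. The triple product with `x = p^(2k+1)`, `z = p^a` cancels the classes `0,
a, b` of `(p)_∞`. -/
lemma hasSum_multiTerm {p : ℂ} (hp : ‖p‖ < 1) (hp0 : p ≠ 0) {e : ℕ} (he : e ≤ 1) {m a b : ℕ}
    (ha : a = (m + 1) * (e + 1)) (hb : 0 < b) (hab : a + b = 2 * (m + 1) + 1)
    {A : Set ℕ} (hA : ∀ r, r ∈ A ↔ 1 ≤ r ∧ r % (a + b) ≠ 0 ∧ r % (a + b) ≠ a ∧ r % (a + b) ≠ b) :
    Multipliable (fun r : A => 1 / (1 - p ^ (r : ℕ))) ∧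
      HasSum (fun n : Fin m → ℕ => multiTerm p e n) (∏' r : A, 1 / (1 - p ^ (r : ℕ))) := by
  have hA0 : ∏' r : A, (1 - p ^ (r : ℕ)) ≠ 0 :=
    tprod_one_sub_pow_ne_zero hp Subtype.val_injective
      fun r => Nat.one_le_iff_ne_zero.mp ((hA r).mp r.2).1
  have hprod := (multipliable_one_sub_pow_of_injective hp
    (Subtype.val_injective (p := (· ∈ A)))).hasProd.inv₀ hA0
  simp only [one_div]
  refine ⟨hprod.multipliable, ?_⟩
  rw [hprod.tprod_eq]
  have hinj : ∀ c, Function.Injective fun n : ℕ => c + (a + b) * n := fun c =>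
    injective_add_mul c (by omega)
  have hx1 : ‖p ^ (a + b)‖ < 1 := by
    rw [norm_pow]; exact pow_lt_one₀ (norm_nonneg p) hp (by omega)
  have e1 : (fun n : ℕ => 1 - p ^ a * (p ^ (a + b)) ^ n) = fun n => 1 - p ^ (a + (a + b) * n) := by
    ext n; rw [← pow_mul, ← pow_add]
  have e2 : (fun n : ℕ => 1 - (p ^ (a + b)) ^ (n + 1) / p ^ a) =
      fun n => 1 - p ^ (b + (a + b) * n) := by
    ext n
    rw [← pow_mul, show (a + b) * (n + 1) = b + (a + b) * n + a by ring, pow_add p _ a,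
      mul_div_cancel_right₀ _ (pow_ne_zero _ hp0)]
  have hc : chainCoeff p e (m + 1) = thetaTerm (p ^ (a + b)) (p ^ a) := by
    ext r; rw [chainCoeff_eq_thetaTerm hp0, hab, ha]
  have hs := summable_norm_chainCoeff hp hp0 he (m + 1)
  rw [hc] at hs
  have hJ := jacobi_triple_product hx1 (pow_ne_zero _ hp0) (pow_ne_zero a hp0) hs
    (by rw [e1]; exact multipliable_one_sub_pow_of_injective hp (hinj a))
    (by rw [e2]; exact multipliable_one_sub_pow_of_injective hp (hinj b))
  have hT := tsum_multiTerm hp hp0 he m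
  have ha0 : 0 < a := by rw [ha]; positivity
  have hsplit := qpInf_eq_tprod_mul hp ha0 hb (by omega) (Nat.lt_add_of_pos_right hb)
    (Nat.lt_add_of_pos_left ha0) hA
  rw [hc, hJ, e1, e2] at hT
  have hsum := (summable_norm_multiTerm hp e m).of_norm.hasSum
  suffices h : (∏' r : A, (1 - p ^ (r : ℕ)))⁻¹ = ∑' n : Fin m → ℕ, multiTerm p e n by
    exact h ▸ hsum
  rw [hT, hsplit, mul_inv_rev, ← mul_assoc, mul_inv_cancel₀, one_mul]
  -- The triple product is a factor of `(p)_∞ ≠ 0`.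
  refine right_ne_zero_of_mul (a := ∏' r : A, (1 - p ^ (r : ℕ))) ?_
  rw [← hsplit]
  exact qpInf_ne_zero hp

/-! ### Translation back to `q`. -/

lemma poch_one_div (q : ℂ) (n : ℕ) : poch q (1 / q) n = qp (1 / q) n :=
  Finset.prod_congr rfl fun i _ => by rw [pow_succ, one_div_pow]; ring

lemma multiTerm_one_div (q : ℂ) (e : ℕ) {m : ℕ} (n : Fin m → ℕ) :
    multiTerm (1 / q) e n = 1 / (q ^ (∑ j, tailSum n j ^ 2 + e * ∑ j, tailSum n j) *
      ∏ j, poch q (1 / q) (n j)) := by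
  simp only [poch_one_div, multiTerm, Finset.prod_inv_distrib, one_div_pow]
  simp only [one_div, mul_inv]

lemma mem_allowed_iff {k i : ℕ} (h0 : 0 < i) (hi : i ≤ 2 * k) (r : ℕ) :
    r ∈ allowed k i ↔ 1 ≤ r ∧ r % (2 * k + 1) ≠ 0 ∧ r % (2 * k + 1) ≠ i ∧
      r % (2 * k + 1) ≠ 2 * k + 1 - i := by
  have hz : (r : ℤ) ≡ 0 [ZMOD (2 * k + 1)] ↔ r % (2 * k + 1) = 0 := by
    rw [Int.ModEq, Int.zero_emod]; norm_cast
  have hp : (r : ℤ) ≡ i [ZMOD (2 * k + 1)] ↔ r % (2 * k + 1) = i := by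
    rw [Int.ModEq, Int.emod_eq_of_lt (a := (i : ℤ)) (by omega) (by omega)]; norm_cast
  have hn : (r : ℤ) ≡ -i [ZMOD (2 * k + 1)] ↔ r % (2 * k + 1) = 2 * k + 1 - i := by
    rw [Int.ModEq, ← Int.add_emod_right (-(i : ℤ)),
      Int.emod_eq_of_lt (a := -(i : ℤ) + (2 * k + 1)) (by omega) (by omega),
      show -(i : ℤ) + (2 * k + 1) = (2 * k + 1 - i : ℕ) by omega]
    norm_cast
  simp only [allowed, Set.mem_ofPred_eq, hz, hp, hn, ne_eq]

end Andrews

theorem mainTheorem1 (k : ℕ) (hk : 2 ≤ k) (q : ℂ) (hq : 1 < ‖q‖) :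
    (Multipliable (fun r : Andrews.allowed k k => 1 / (1 - (1 / q) ^ (r : ℕ))) ∧
      HasSum
        (fun n : Fin (k - 1) → ℕ =>
          1 / (q ^ (∑ j, Andrews.tailSum n j ^ 2) * ∏ j, Andrews.poch q (1 / q) (n j)))
        (∏' r : Andrews.allowed k k, 1 / (1 - (1 / q) ^ (r : ℕ)))) ∧
    (Multipliable (fun r : Andrews.allowed k 1 => 1 / (1 - (1 / q) ^ (r : ℕ))) ∧
      HasSum
        (fun n : Fin (k - 1) → ℕ =>
          1 / (q ^ (∑ j, Andrews.tailSum n j ^ 2 + ∑ j, Andrews.tailSum n j) *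
            ∏ j, Andrews.poch q (1 / q) (n j)))
        (∏' r : Andrews.allowed k 1, 1 / (1 - (1 / q) ^ (r : ℕ)))) := by
  obtain ⟨m, rfl⟩ : ∃ m, k = m + 1 := ⟨k - 1, by omega⟩
  have hq0 : q ≠ 0 := norm_pos_iff.mp (one_pos.trans hq)
  have hp0 : 1 / q ≠ 0 := one_div_ne_zero hq0
  have hp : ‖1 / q‖ < 1 := by
    rw [norm_div, norm_one, one_div]; exact inv_lt_one_of_one_lt₀ hq
  have h0 := Andrews.hasSum_multiTerm hp hp0 (e := 0) zero_le_one (m := m) (a := m + 1)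
    (b := m + 2) (by ring) (by omega) (by ring) (A := Andrews.allowed (m + 1) (m + 1)) fun r => by
      rw [Andrews.mem_allowed_iff (by omega) (by omega),
        show 2 * (m + 1) + 1 - (m + 1) = m + 2 by omega,
        show 2 * (m + 1) + 1 = m + 1 + (m + 2) by ring]
  have h1 := Andrews.hasSum_multiTerm hp hp0 (e := 1) le_rfl (m := m) (a := 2 * (m + 1))
    (b := 1) (by ring) (by omega) (by ring) (A := Andrews.allowed (m + 1) 1) fun r => by
      rw [Andrews.mem_allowed_iff (by omega) (by omega), Nat.add_sub_cancel]
      tauto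
  simp only [Andrews.multiTerm_one_div, zero_mul, one_mul, add_zero] at h0 h1
  exact ⟨h0, h1⟩
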